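/- Let $q$ be a power of an odd prime and let $n\ge 4$ be even. Let $A\in\mathbb F_q^{n\times n}$ be an invertible symmetric matrix whose quadric $\{\langle \mathbf x\rangle : \mathbf x\in\mathbb F_q^n\setminus\{0\},\ \mathbf x^{\top}A\mathbf x=0\}$ is elliptic, that is, it consists of exactly $\frac{(q^{n/2}+1)(q^{n/2-1}-1)}{q-1}$ one-dimensional subspaces. Let $VO_n^-(q)$ be the corresponding elliptic affine polar graph: its vertex set is $\mathbb F_q^n$, and two distinct vectors $\mathbf x,\mathbf y$ are adjacent if and only if $(\mathbf x-\mathbf y)^{\top}A(\mathbf x-\mathbf y)=0$. (Up to isomorphism, it does not depend on the choice of $A$.) A graph is called a core if all its endomorphisms are automorphisms; a core of a graph $\Gamma$ is a subgraph $\Gamma'$ of $\Gamma$ that is a core and admits a graph homomorphism $\Gamma\to\Gamma'$. Write $\omega(\Gamma)$ and $\alpha(\Gamma)$ for the clique number and the independence number of $\Gamma$. Then $VO_n^-(q)$ is a core. In particular, neither a core of $VO_n^-(q)$ nor a core of its complement $\overline{VO_n^-(q)}$ is a complete graph, and $$\omega\big(VO_n^-(q)\big)\,\alpha\big(VO_n^-(q)\big)<\big|V\big(VO_n^-(q)\big)\big|=q^n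 .$$ -/

import Mathlib

open scoped Matrix

/-- A graph is a *core* if every endomorphism of it is an automorphism. -/
def IsCore {V : Type*} (G : SimpleGraph V) : Prop :=
  ∀ f : G →g G, ∃ e : G ≃g G, ∀ v : V, e v = f v

/-- A subgraph `H` of `G` is a *core of `G`* if `H`, as a graph on its own vertex set, is a core
and there is some graph homomorphism from `G` to `H`. -/
def IsCoreOf {V : Type*} {G : SimpleGraph V} (H : G.Subgraph) : Prop :=
  IsCore H.coe ∧ Nonempty (G →g H.coe)

/-- The quadric of a matrix `A`: the set of all one-dimensional subspaces `⟨x⟩` of `F^n` spanned by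
a nonzero column vector `x` with `xᵀ A x = 0`. -/
def quadric {F : Type*} [Field F] {n : ℕ} (A : Matrix (Fin n) (Fin n) F) :
    Set (Submodule F (Fin n → F)) :=
  {U | ∃ x : Fin n → F, x ≠ 0 ∧ x ⬝ᵥ (A *ᵥ x) = 0 ∧ U = Submodule.span F {x}}

/-- `A` is an invertible symmetric `n × n` matrix over the finite field with `q` elements, `n ≥ 2` is
even, and the quadric of `A` is elliptic, i.e. it has `(q^(n/2) + 1)(q^(n/2-1) - 1)/(q - 1)` points.
(Both subtractions below are of natural numbers `≥ 1`, so nothing is truncated.) -/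
structure IsElliptic {F : Type*} [Field F] [Fintype F] {n : ℕ}
    (A : Matrix (Fin n) (Fin n) F) : Prop where
  symm : A.IsSymm
  invertible : IsUnit A
  two_le : 2 ≤ n
  even : Even n
  card_quadric : (quadric A).ncard * (Fintype.card F - 1) =
    (Fintype.card F ^ (n / 2) + 1) * (Fintype.card F ^ (n / 2 - 1) - 1)

/-- The affine polar graph with defining matrix `A`: the vertices are the column vectors in `F^n`, and
two distinct vectors `x`, `y` are adjacent iff `(x - y)ᵀ A (x - y) = 0`. It is the graph `VO_n^-(q)`
when `A` is elliptic. -/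
def affinePolarGraph {F : Type*} [Field F] {n : ℕ} (A : Matrix (Fin n) (Fin n) F) :
    SimpleGraph (Fin n → F) where
  Adj x y := x ≠ y ∧ (x - y) ⬝ᵥ (A *ᵥ (x - y)) = 0
  symm := ⟨fun x y h => ⟨h.1.symm, by
    have h2 := h.2
    rw [← neg_sub x y, Matrix.mulVec_neg, neg_dotProduct_neg]
    exact h2⟩⟩
  loopless := ⟨fun _ h => h.1 rfl⟩

/-!
Write `Q x = xᵀ A x`, let `B` be its bilinear form, `n = 2 m`, and let `G` be the affine polar graph.

The bound `ω α < q ^ n` implies everything else. The fibres of a homomorphism are independent, so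
an endomorphism of `G` whose image is a clique gives `q ^ n ≤ ω α`; a complete core of `G` or of its
complement provides one (in the complement, `ω` and `α` are exchanged). If `G` is not a core, some
endomorphism merges two nonadjacent vertices. The automorphism group is transitive on ordered
nonadjacent pairs, so an endomorphism with smallest image must have a clique as its image
(`SimpleGraph.isCore_of_transitive`). The transitivity says that similitudes of `B` are transitive
on vectors with `Q x ≠ 0` (`exists_isSimilitude_apply_eq`): reflections act transitively, up to
sign, on the vectors of a given nonzero norm, and in even dimension every nonzero scalar is the
multiplier of a similitude, built from `2 × 2` blocks in an orthogonal basis.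

The bound itself is Hoffman's ratio bound for `G` and its complement, obtained without characters.
For a set `C` of vectors and any `w`, Cauchy–Schwarz gives
`|C| ^ 2 ≤ q * #{(x, y) ∈ C × C | B w (x - y) = 0}`. Summing over all nonzero singular `w` when `C` is
a clique, and over all non-singular `w` when `C` is independent, leaves only the number of such `w`
orthogonal to a given singular, respectively non-singular, vector. For singular vectors this is a
count along lines, and for non-singular ones it follows by counting orthogonal pairs twice, since it
is constant by transitivity. With `t = q ^ (m - 1)` and `D = (q - 1) t + 1` the result is
`ω D ≤ q t ^ 2` (`card_mul_le_of_sub_singular`) and `α ≤ q D` (`card_le_of_sub_nonsingular`), whence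
`ω α ≤ q ^ 2 t ^ 2 = q ^ n`. Equality would make `D > 1` a divisor of a power of `q`, while `D` is
congruent to `1` modulo `q` (`mul_lt_of_bounds`).
-/

/-! ### Similitudes act transitively on non-singular vectors -/

section Similitude

variable {F V : Type*} [Field F] [AddCommGroup V] [Module F V]

/-- The linear map `e` is a similitude of the bilinear form `B`: it multiplies `B` by a nonzero
scalar. -/
def IsSimilitude (B : LinearMap.BilinForm F V) (e : V →ₗ[F] V) : Prop :=
  ∃ c : F, c ≠ 0 ∧ ∀ u v, B (e u) (e v) = c * B u v

namespace IsSimilitude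

variable {B : LinearMap.BilinForm F V} {e e' : V →ₗ[F] V}

theorem comp (h : IsSimilitude B e) (h' : IsSimilitude B e') : IsSimilitude B (e ∘ₗ e') := by
  obtain ⟨c, hc, h⟩ := h
  obtain ⟨d, hd, h'⟩ := h'
  exact ⟨c * d, mul_ne_zero hc hd, fun u v => by simp [h, h', mul_assoc]⟩

theorem apply_eq_zero_iff (h : IsSimilitude B e) (u v : V) : B (e u) (e v) = 0 ↔ B u v = 0 := by
  obtain ⟨c, hc, h⟩ := h
  simp [h, hc]

theorem injective (hB : B.Nondegenerate) (h : IsSimilitude B e) : Function.Injective e := by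
  rw [injective_iff_map_eq_zero]
  intro x hx
  refine hB.1 x fun y => ?_
  rw [← h.apply_eq_zero_iff, hx]
  simp

end IsSimilitude

theorem isSimilitude_neg (B : LinearMap.BilinForm F V) : IsSimilitude B (-LinearMap.id) :=
  ⟨1, one_ne_zero, fun u v => by simp⟩

/-- Two vectors whose difference is non-singular and which have the same norm are exchanged by the
reflection in their difference. -/
theorem exists_isometry_of_sub_ne_zero {B : LinearMap.BilinForm F V} (hs : B.IsSymm) {x y : V}
    (hxy : B x x = B y y) (h : B (x - y) (x - y) ≠ 0) :
    ∃ e : V →ₗ[F] V, IsSimilitude B e ∧ e x = y := by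
  have hyx : B y x = B x y := hs.eq y x
  have hr : B (x - y) (x - y) = 2 * B (x - y) x := by
    simp only [map_sub, LinearMap.sub_apply, hyx, ← hxy]
    ring
  refine ⟨LinearMap.id - (2 / B (x - y) (x - y)) • (B (x - y)).smulRight (x - y),
    ⟨1, one_ne_zero, fun u v => ?_⟩, ?_⟩
  · have hu : ∀ u, B u (x - y) = B (x - y) u := fun u => hs.eq u (x - y)
    clear hr
    generalize x - y = w at *
    simp only [LinearMap.sub_apply, LinearMap.id_apply, LinearMap.smul_apply,
      LinearMap.smulRight_apply, map_sub, map_smul, smul_eq_mul, hu]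
    field_simp
    ring
  · have h1 : 2 / B (x - y) (x - y) * B (x - y) x = 1 := by
      rw [div_mul_eq_mul_div, ← hr, div_self h]
    rw [LinearMap.sub_apply, LinearMap.smul_apply, LinearMap.smulRight_apply, smul_smul, h1]
    simp

/-- If `B x x = B y y ≠ 0`, one of `x - y` and `x + y` is non-singular, so that a reflection takes
`x` to `y` or to `-y`. -/
theorem exists_isometry_of_norm_eq {B : LinearMap.BilinForm F V} (hs : B.IsSymm)
    (h2 : (2 : F) ≠ 0) {x y : V} (hxy : B x x = B y y) (hx : B x x ≠ 0) :
    ∃ e : V →ₗ[F] V, IsSimilitude B e ∧ e x = y := by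
  by_cases h : B (x - y) (x - y) = 0
  · have h' : B (x - -y) (x - -y) ≠ 0 := by
      intro h'
      have : 2 * (2 * B x x) = 0 := by
        have := congrArg₂ (· + ·) h h'
        simp only [map_sub, map_neg, LinearMap.sub_apply, LinearMap.neg_apply, ← hxy] at this
        linear_combination this
      simp [h2, hx] at this
    obtain ⟨e, he, hexy⟩ := exists_isometry_of_sub_ne_zero hs (x := x) (y := -y) (by simpa) h'
    exact ⟨_, (isSimilitude_neg B).comp he, by simp [hexy]⟩
  · exact exists_isometry_of_sub_ne_zero hs hxy h

/-- A binary form `a x² + b y²` over a finite field of odd order represents everything. -/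
theorem exists_binary_eq [Fintype F] (hq : Odd (Fintype.card F)) {a b : F} (ha : a ≠ 0)
    (hb : b ≠ 0) (c : F) : ∃ x y : F, a * x ^ 2 + b * y ^ 2 = c := by
  open Polynomial in
  obtain ⟨x, y, h⟩ := FiniteField.exists_root_sum_quadratic
    (f := C a * X ^ 2) (g := C b * X ^ 2 - C c) (degree_C_mul_X_pow 2 ha)
    (by compute_degree!) (Nat.odd_iff.1 hq)
  refine ⟨x, y, ?_⟩
  simp at h
  linear_combination h

/-- In even dimension over a finite field of odd order, every nonzero scalar `c` is the multiplier
of a similitude. Pair up the vectors of an orthogonal basis; on a pair of norms `α`, `β`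
with `α x² + β y² = c α`, the matrix with columns `(x, y)` and `(-(β / α) y, x)` multiplies the form
by `c`. -/
theorem exists_similitude [Fintype F] (hq : Odd (Fintype.card F)) [FiniteDimensional F V]
    {B : LinearMap.BilinForm F V} (hs : B.IsSymm) (hB : B.Nondegenerate) (h2 : (2 : F) ≠ 0)
    {m : ℕ} (hm : Module.finrank F V = m + m) (c : F) :
    ∃ e : V →ₗ[F] V, ∀ u v, B (e u) (e v) = c * B u v := by
  have := invertibleOfNonzero h2
  obtain ⟨b₀, hb₀⟩ := LinearMap.BilinForm.exists_orthogonal_basis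
    (LinearMap.BilinForm.isSymm_iff.1 hs)
  let b := b₀.reindex ((finCongr hm).trans finSumFinEquiv.symm)
  have hb : ∀ i j, i ≠ j → B (b i) (b j) = 0 := fun i j hij => by
    simp only [b, Module.Basis.reindex_apply]
    exact hb₀ (by simpa using hij)
  have hd : ∀ i, B (b i) (b i) ≠ 0 := fun i => by
    simp only [b, Module.Basis.reindex_apply]
    exact hb₀.not_isOrtho_basis_self_of_separatingLeft hB.1 _
  choose x y hxy using fun i : Fin m =>
    exists_binary_eq hq (hd (Sum.inl i)) (hd (Sum.inr i)) (c * B (b (Sum.inl i)) (b (Sum.inl i)))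
  let e : V →ₗ[F] V := b.constr F (Sum.elim
    (fun i => x i • b (Sum.inl i) + y i • b (Sum.inr i))
    (fun i => (-(B (b (Sum.inr i)) (b (Sum.inr i)) / B (b (Sum.inl i)) (b (Sum.inl i))) * y i) •
      b (Sum.inl i) + x i • b (Sum.inr i)))
  have key : B.compl₁₂ e e = c • B := by
    refine LinearMap.ext_basis b b fun i j => ?_
    have hlr : ∀ i j, B (b (Sum.inl i)) (b (Sum.inr j)) = 0 := fun i j => hb _ _ (by simp)
    have hrl : ∀ i j, B (b (Sum.inr i)) (b (Sum.inl j)) = 0 := fun i j => hb _ _ (by simp)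
    have hll : ∀ i j, i ≠ j → B (b (Sum.inl i)) (b (Sum.inl j)) = 0 :=
      fun i j h => hb _ _ (by simpa)
    have hrr : ∀ i j, i ≠ j → B (b (Sum.inr i)) (b (Sum.inr j)) = 0 :=
      fun i j h => hb _ _ (by simpa)
    rcases i with i | i <;> rcases j with j | j <;> by_cases hij : i = j
    all_goals
      simp only [e, LinearMap.compl₁₂_apply, Module.Basis.constr_basis, Sum.elim_inl, Sum.elim_inr,
        map_add, map_smul, LinearMap.add_apply, LinearMap.smul_apply, smul_eq_mul, hlr, hrl,
        mul_zero, zero_add, add_zero]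
    all_goals
      first
      | subst hij
        have h1 := hxy i
        have h0 := hd (Sum.inl i)
        try field_simp
        try linear_combination h1
        try linear_combination B (b (Sum.inr i)) (b (Sum.inr i)) * h1
        try ring
      | simp [hll _ _ hij, hrr _ _ hij]
  exact ⟨e, fun u v => by simpa using LinearMap.congr_fun₂ key u v⟩

theorem exists_isSimilitude_apply_eq [Fintype F] (hq : Odd (Fintype.card F))
    [FiniteDimensional F V] {B : LinearMap.BilinForm F V} (hs : B.IsSymm) (hB : B.Nondegenerate)
    (h2 : (2 : F) ≠ 0) {m : ℕ} (hm : Module.finrank F V = m + m) {x y : V}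
    (hx : B x x ≠ 0) (hy : B y y ≠ 0) :
    ∃ e : V →ₗ[F] V, IsSimilitude B e ∧ e x = y := by
  obtain ⟨e, he⟩ := exists_similitude hq hs hB h2 hm (B y y / B x x)
  have hex : B (e x) (e x) = B y y := by rw [he, div_mul_cancel₀ _ hx]
  obtain ⟨e', he', h⟩ := exists_isometry_of_norm_eq hs h2 hex (hex ▸ hy)
  exact ⟨_, he'.comp ⟨_, div_ne_zero hy hx, he⟩, h⟩

end Similitude

/-! ### Graph homomorphisms, complete images and cores -/

namespace SimpleGraph

variable {V : Type*} [Finite V] {G : SimpleGraph V}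

/-- The fibres of a homomorphism are independent, so a homomorphism onto a clique bounds the number
of vertices by the clique number times the independence number. -/
theorem card_le_cliqueNum_mul_indepNum (f : G →g G) (hf : G.IsClique (Set.range f)) :
    Nat.card V ≤ G.cliqueNum * G.indepNum := by
  classical
  have := Fintype.ofFinite V
  have h1 : (Finset.univ.image f).card ≤ G.cliqueNum :=
    IsClique.card_le_cliqueNum (tc := by simpa using hf)
  rw [Nat.card_eq_fintype_card, ← Finset.card_univ]
  calc Finset.univ.card ≤ G.indepNum * (Finset.univ.image f).card := by
        refine Finset.card_le_mul_card_image _ _ fun b _ => ?_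
        refine IsIndepSet.card_le_indepNum (t := Finset.univ.filter fun a => f a = b) ?_
        intro x hx y hy _ hxy
        have := f.map_adj hxy
        simp only [Finset.coe_filter, Finset.mem_univ, true_and, Set.mem_ofPred_eq] at hx hy
        rw [hx, hy] at this
        exact G.loopless.irrefl _ this
    _ ≤ G.cliqueNum * G.indepNum := by
        rw [mul_comm]
        exact Nat.mul_le_mul_right _ h1

theorem card_le_of_isCoreOf_eq_top {H : G.Subgraph} (hH : IsCoreOf H) (ht : H.coe = ⊤) :
    Nat.card V ≤ G.cliqueNum * G.indepNum := by
  obtain ⟨f⟩ := hH.2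
  refine card_le_cliqueNum_mul_indepNum (H.hom.comp f) ?_
  rintro _ ⟨x, rfl⟩ _ ⟨y, rfl⟩ hxy
  have hadj : ∀ u v, u ≠ v → H.coe.Adj u v := by simp [ht]
  exact H.hom.map_adj (hadj (f x) (f y) fun h => hxy (by simp [h]))

/-- On a finite graph, some power of a bijective endomorphism is the identity, hence its inverse is
a power of it and an endomorphism as well. -/
theorem exists_iso_of_injective (f : G →g G) (hf : Function.Injective f) :
    ∃ e : G ≃g G, ∀ v, e v = f v := by
  let p : Equiv.Perm V := Equiv.ofBijective f (Finite.injective_iff_bijective.1 hf)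
  have hp : ∀ k : ℕ, ∀ x y, G.Adj x y → G.Adj ((p ^ k) x) ((p ^ k) y) := by
    intro k
    induction k with
    | zero => simp
    | succ k ih =>
      intro x y h
      rw [pow_succ']
      exact f.map_adj (ih x y h)
  refine ⟨⟨p, fun {x y} => ⟨fun h => ?_, fun h => f.map_adj h⟩⟩, fun v => rfl⟩
  have hinv : p ^ (orderOf p - 1) * p = 1 := by
    rw [← pow_succ, Nat.sub_add_cancel (orderOf_pos p), pow_orderOf_eq_one]
  have := hp (orderOf p - 1) _ _ h
  rwa [← Equiv.Perm.mul_apply, ← Equiv.Perm.mul_apply, hinv] at this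

/-- Suppose that the automorphism group is transitive on ordered pairs of distinct nonadjacent
vertices. An endomorphism `g` with smallest image either has a clique as its image, or an
automorphism moves a nonadjacent pair of the image to a pair that a given non-injective `f`
merges, and composing with `f` shrinks the image. A clique as image contradicts `ω α < |V|`. -/
theorem isCore_of_transitive
    (htrans : ∀ x y x' y' : V, x ≠ y → ¬ G.Adj x y → x' ≠ y' → ¬ G.Adj x' y' →
      ∃ σ : G →g G, σ x = x' ∧ σ y = y')
    (hlt : G.cliqueNum * G.indepNum < Nat.card V) : IsCore G := by
  intro f
  refine exists_iso_of_injective f ?_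
  by_contra hf
  obtain ⟨x', y', hxy', hne⟩ := Function.not_injective_iff.1 hf
  have hnadj : ¬ G.Adj x' y' := fun h => G.loopless.irrefl (f x') (by
    have := f.map_adj h
    rwa [← hxy'] at this)
  obtain ⟨g, hg⟩ : ∃ g : G →g G, ∀ g' : G →g G, (Set.range g).ncard ≤ (Set.range g').ncard := by
    have : (Set.range fun g : G →g G => (Set.range g).ncard).Nonempty := ⟨_, Hom.id, rfl⟩
    obtain ⟨⟨g, hg⟩, h⟩ := Nat.sInf_mem this, fun n hn => Nat.sInf_le (m := n)
      (s := Set.range fun g : G →g G => (Set.range g).ncard) hn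
    exact ⟨g, fun g' => hg.trans_le (h _ ⟨g', rfl⟩)⟩
  refine hlt.not_ge (card_le_cliqueNum_mul_indepNum g ?_)
  rintro _ ⟨x, rfl⟩ _ ⟨y, rfl⟩ hxy
  by_contra hadj
  obtain ⟨σ, hx, hy⟩ := htrans _ _ _ _ hxy hadj hne hnadj
  have hlt' : (f ∘ σ '' Set.range g).ncard < (Set.range g).ncard := by
    refine (Set.ncard_image_le (Set.toFinite _)).lt_of_ne fun h => hxy ?_
    exact Set.injOn_of_ncard_image_eq h (Set.toFinite _) ⟨x, rfl⟩ ⟨y, rfl⟩ (by simp [hx, hy, hxy'])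
  refine hlt'.not_ge ((hg ((f.comp σ).comp g)).trans_eq ?_)
  congr 1
  ext z
  simp

end SimpleGraph

/-! ### Counting singular vectors in hyperplanes -/

section Counting

open scoped Classical in
/-- Counting pairs of a finite set with equal image, by the Cauchy–Schwarz inequality. -/
theorem sq_card_le_card_mul_card_pairs {α β : Type*} [Fintype β] (f : α → β) (C : Finset α) :
    C.card ^ 2 ≤ Fintype.card β * ((C ×ˢ C).filter fun p => f p.1 = f p.2).card := by
  have h1 : C.card = ∑ b : β, (C.filter fun a => f a = b).card :=
    Finset.card_eq_sum_card_fiberwise fun _ _ => Finset.mem_univ _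
  have h2 : ((C ×ˢ C).filter fun p => f p.1 = f p.2).card =
      ∑ b : β, (C.filter fun a => f a = b).card ^ 2 := by
    rw [Finset.card_eq_sum_card_fiberwise (f := fun p => f p.1) (t := Finset.univ)
      fun _ _ => Finset.mem_univ _]
    refine Finset.sum_congr rfl fun b _ => ?_
    rw [sq, ← Finset.card_product]
    congr 1
    ext p
    simp only [Finset.mem_filter, Finset.mem_product]
    constructor
    · rintro ⟨⟨⟨h1, h2⟩, h3⟩, h4⟩
      exact ⟨⟨h1, h4⟩, h2, h3 ▸ h4⟩
    · rintro ⟨⟨h1, h2⟩, h3, h4⟩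
      exact ⟨⟨⟨h1, h3⟩, h2.trans h4.symm⟩, h2⟩
  rw [h2]
  conv_lhs => rw [h1]
  exact sq_sum_le_card_mul_sum_sq

variable {F V : Type*} [Field F] [AddCommGroup V] [Module F V]

open scoped Classical in
/-- A Hoffman-type bound on `C` when every nonzero difference of elements of `C` is orthogonal to
the same number `P` of vectors of `W`. -/
theorem sq_card_mul_card_add_le [Fintype F] (B : LinearMap.BilinForm F V) (W C : Finset V) (P : ℕ)
    (hP : ∀ x ∈ C, ∀ y ∈ C, x ≠ y → (W.filter fun w => B w (x - y) = 0).card = P) :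
    C.card ^ 2 * W.card + Fintype.card F * C.card * P ≤
      Fintype.card F * C.card * W.card + Fintype.card F * C.card ^ 2 * P := by
  have h1 : C.card ^ 2 * W.card ≤ Fintype.card F *
      ∑ w ∈ W, ((C ×ˢ C).filter fun p => B w p.1 = B w p.2).card := by
    rw [mul_comm, ← smul_eq_mul, ← Finset.sum_const, Finset.mul_sum]
    exact Finset.sum_le_sum fun w _ => sq_card_le_card_mul_card_pairs (fun x => B w x) C
  have h2 : ∑ w ∈ W, ((C ×ˢ C).filter fun p => B w p.1 = B w p.2).card =
      ∑ p ∈ C ×ˢ C, (W.filter fun w => B w p.1 = B w p.2).card := by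
    simp_rw [Finset.card_filter]
    exact Finset.sum_comm
  have h3 : ∑ p ∈ C ×ˢ C, (W.filter fun w => B w p.1 = B w p.2).card =
      C.card * W.card + (C.card * C.card - C.card) * P := by
    rw [← Finset.diag_union_offDiag, Finset.sum_union (Finset.disjoint_diag_offDiag _)]
    congr 1
    · rw [Finset.sum_congr rfl (g := fun _ => W.card), Finset.sum_const, Finset.diag_card,
        smul_eq_mul]
      intro p hp
      rw [(Finset.mem_diag.1 hp).2]
      simp
    · rw [Finset.sum_congr rfl (g := fun _ => P), Finset.sum_const, Finset.offDiag_card,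
        smul_eq_mul]
      intro p hp
      obtain ⟨hx, hy, hne⟩ := Finset.mem_offDiag.1 hp
      simpa [sub_eq_zero] using hP _ hx _ hy hne
  rw [h2, h3] at h1
  zify [Nat.le_mul_self C.card] at h1 ⊢
  linarith

variable [Fintype V]

open scoped Classical in
/-- The nonzero singular vectors of the form `x ↦ B x x`. -/
noncomputable def singularVectors (B : LinearMap.BilinForm F V) : Finset V :=
  Finset.univ.filter fun x => x ≠ 0 ∧ B x x = 0

open scoped Classical in
/-- The non-singular vectors of the form `x ↦ B x x`. -/
noncomputable def nonsingularVectors (B : LinearMap.BilinForm F V) : Finset V :=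
  Finset.univ.filter fun x => B x x ≠ 0

variable (B : LinearMap.BilinForm F V)

theorem mem_singularVectors {x : V} : x ∈ singularVectors B ↔ x ≠ 0 ∧ B x x = 0 := by
  simp [singularVectors]

theorem mem_nonsingularVectors {x : V} : x ∈ nonsingularVectors B ↔ B x x ≠ 0 := by
  simp [nonsingularVectors]

open scoped Classical in
/-- Zero, the nonzero singular vectors and the non-singular vectors partition every
subspace. -/
theorem card_filter_add_card_filter (f : V →ₗ[F] F) :
    ((singularVectors B).filter fun z => f z = 0).card + 1 +
      ((nonsingularVectors B).filter fun z => f z = 0).card =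
      (Finset.univ.filter fun z => f z = 0).card := by
  rw [← Finset.card_insert_of_notMem (a := (0 : V)) (by simp [mem_singularVectors]),
    ← Finset.card_union_of_disjoint]
  · congr 1
    ext z
    simp only [Finset.mem_union, Finset.mem_insert, Finset.mem_filter, mem_singularVectors,
      mem_nonsingularVectors, Finset.mem_univ, true_and]
    by_cases hz : z = 0
    · simp [hz]
    · simp only [hz, false_or, ne_eq, not_false_eq_true, true_and]
      tauto
  · rw [Finset.disjoint_left]
    intro z hz hz'
    simp only [Finset.mem_insert, Finset.mem_filter, mem_singularVectors,
      mem_nonsingularVectors] at hz hz'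
    rcases hz with rfl | hz
    · simp at hz'
    · exact hz'.1 hz.1.2

theorem card_singularVectors_add :
    (singularVectors B).card + 1 + (nonsingularVectors B).card = Fintype.card V := by
  classical
  simpa using card_filter_add_card_filter B 0

variable [Fintype F]

open scoped Classical in
theorem card_mul_card_filter_eq_zero (f : V →ₗ[F] F) (hf : f ≠ 0) :
    Fintype.card F * (Finset.univ.filter fun z => f z = 0).card = Fintype.card V := by
  have h := Submodule.card_eq_card_quotient_mul_card (LinearMap.ker f)
  rw [Nat.card_congr (f.quotKerEquivOfSurjective (LinearMap.surjective hf)).toEquiv,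
    Nat.card_eq_fintype_card, Nat.card_eq_fintype_card] at h
  rw [h, Nat.card_eq_fintype_card, Fintype.card_subtype, mul_comm]
  simp

variable {B}

open scoped Classical in
/-- For a singular vector `w`, each line in direction `w` that is not orthogonal to `w` has exactly
one singular vector. -/
theorem card_mul_card_singularVectors_not_orthogonal (hs : B.IsSymm) (h2 : (2 : F) ≠ 0) {w : V}
    (hw : B w w = 0) :
    Fintype.card F * ((singularVectors B).filter fun z => ¬ B w z = 0).card =
      (Finset.univ.filter fun z => ¬ B w z = 0).card := by
  rw [← Finset.card_univ, ← Finset.card_product]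
  have hsw : ∀ z, B z w = B w z := fun z => hs.eq z w
  refine Finset.card_nbij' (fun p => p.2 + p.1 • w)
    (fun z => (B z z / (2 * B w z), z - (B z z / (2 * B w z)) • w)) ?_ ?_ ?_ ?_
  · rintro ⟨t, z⟩ h
    simp only [Finset.coe_product, Finset.coe_filter, mem_singularVectors, Set.mem_prod,
      Set.mem_ofPred_eq] at h
    simpa [hw] using h.2.2
  · intro z h
    have h : B w z ≠ 0 := by simpa using h
    have h' : B w (z - (B z z / (2 * B w z)) • w) ≠ 0 := by simpa [hw] using h
    simp only [Finset.coe_product, Finset.coe_filter, mem_singularVectors, Set.mem_prod,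
      Set.mem_ofPred_eq, Finset.coe_univ, Set.mem_univ, true_and]
    refine ⟨⟨fun h0 => h' (by simp [h0]), ?_⟩, h'⟩
    simp only [map_sub, map_smul, LinearMap.sub_apply, LinearMap.smul_apply, smul_eq_mul, hw, hsw]
    field_simp
    ring
  · rintro ⟨t, z⟩ h
    simp only [Finset.coe_product, Finset.coe_filter, mem_singularVectors, Set.mem_prod,
      Set.mem_ofPred_eq] at h
    obtain ⟨-, ⟨-, hz⟩, hwz⟩ := h
    replace hwz : B w z ≠ 0 := hwz
    have : B (z + t • w) (z + t • w) / (2 * B w (z + t • w)) = t := by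
      simp only [map_add, map_smul, LinearMap.add_apply, LinearMap.smul_apply, smul_eq_mul, hw,
        hsw, hz, mul_zero, add_zero, zero_add]
      field_simp
      ring
    refine Prod.ext this ?_
    dsimp only
    rw [this, add_sub_cancel_right]
  · intro z _
    simp

open scoped Classical in
/-- By transitivity of the similitudes, the number of singular vectors orthogonal to a non-singular
vector does not depend on that vector. -/
theorem card_singularVectors_orthogonal_eq [FiniteDimensional F V] (hq : Odd (Fintype.card F))
    (hs : B.IsSymm) (hB : B.Nondegenerate) (h2 : (2 : F) ≠ 0) {m : ℕ}
    (hm : Module.finrank F V = m + m) {x y : V} (hx : B x x ≠ 0) (hy : B y y ≠ 0) :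
    ((singularVectors B).filter fun w => B w x = 0).card =
      ((singularVectors B).filter fun w => B w y = 0).card := by
  have key : ∀ {x y : V}, B x x ≠ 0 → B y y ≠ 0 →
      ((singularVectors B).filter fun w => B w x = 0).card ≤
      ((singularVectors B).filter fun w => B w y = 0).card := by
    intro x y hx hy
    obtain ⟨e, he, rfl⟩ := exists_isSimilitude_apply_eq hq hs hB h2 hm hx hy
    have hinj := he.injective hB
    refine Finset.card_le_card_of_injOn e (fun w hw => ?_) hinj.injOn
    simp only [Finset.coe_filter, mem_singularVectors, Set.mem_ofPred_eq] at hw ⊢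
    rw [he.apply_eq_zero_iff, he.apply_eq_zero_iff, map_ne_zero_iff _ hinj]
    exact hw
  exact le_antisymm (key hx hy) (key hy hx)

end Counting

/-! ### The elliptic case -/

section Elliptic

variable {F V : Type*} [Field F] [Fintype F] [AddCommGroup V] [Module F V] [Fintype V]
  {B : LinearMap.BilinForm F V}

open scoped Classical in
/-- The singular vectors orthogonal to a nonzero singular vector, for a form with as many singular
vectors as an elliptic one; here `t = q ^ (m - 1)` in dimension `2 m`. -/
theorem card_singularVectors_orthogonal_singular (hs : B.IsSymm) (hB : B.Nondegenerate)
    (h2 : (2 : F) ≠ 0) {t : ℕ} (hV : Fintype.card V = Fintype.card F ^ 2 * t ^ 2)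
    (hk : ((singularVectors B).card : ℤ) = (Fintype.card F * t + 1) * (t - 1))
    {w : V} (hw : w ∈ singularVectors B) :
    (((singularVectors B).filter fun z => B w z = 0).card : ℤ) =
        t ^ 2 - Fintype.card F * t + t - 1 ∧
      (((nonsingularVectors B).filter fun z => B w z = 0).card : ℤ) =
        t * (Fintype.card F - 1) * (t + 1) := by
  rw [mem_singularVectors] at hw
  have hq0 : (Fintype.card F : ℤ) ≠ 0 := by exact_mod_cast Fintype.card_ne_zero
  have hf : B w ≠ 0 := fun h => hw.1 (hB.1 w fun y => by rw [h]; rfl)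
  have h1 := card_mul_card_filter_eq_zero (B w) hf
  have h3 := card_mul_card_singularVectors_not_orthogonal hs h2 hw.2
  have h4 := Finset.card_filter_add_card_filter_not (s := singularVectors B) fun z => B w z = 0
  have h5 := Finset.card_filter_add_card_filter_not (s := (Finset.univ : Finset V))
    fun z => B w z = 0
  have h6 := card_filter_add_card_filter B (B w)
  rw [Finset.card_univ] at h5
  rw [hV] at h1 h5
  zify at h1 h3 h4 h5 h6
  have hh : ((Finset.univ.filter fun z => B w z = 0).card : ℤ) = Fintype.card F * t ^ 2 :=
    mul_left_cancel₀ hq0 (by linear_combination h1)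
  have hP : (((singularVectors B).filter fun z => B w z = 0).card : ℤ) =
      t ^ 2 - Fintype.card F * t + t - 1 :=
    mul_left_cancel₀ hq0
      (by linear_combination (Fintype.card F : ℤ) * h4 - h3 - h5 + hh + (Fintype.card F : ℤ) * hk)
  exact ⟨hP, by linear_combination h6 - hP + hh⟩

open scoped Classical in
/-- Orthogonal pairs of a singular and a non-singular vector, counted in two ways. -/
theorem card_nonsingularVectors_orthogonal_nonsingular (hq : Odd (Fintype.card F)) (hs : B.IsSymm)
    (hB : B.Nondegenerate) (h2 : (2 : F) ≠ 0) {m : ℕ} (hm : Module.finrank F V = m + m)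
    {t : ℕ} (ht : t ≠ 0) (hV : Fintype.card V = Fintype.card F ^ 2 * t ^ 2)
    (hk : ((singularVectors B).card : ℤ) = (Fintype.card F * t + 1) * (t - 1))
    {x : V} (hx : x ∈ nonsingularVectors B) :
    (((nonsingularVectors B).filter fun z => B z x = 0).card : ℤ) =
      (Fintype.card F - 1) * t ^ 2 := by
  have hq1 : 1 < Fintype.card F := Fintype.one_lt_card
  have hq0 : (Fintype.card F : ℤ) ≠ 0 := by positivity
  rw [mem_nonsingularVectors] at hx
  have hdc : ∑ z ∈ nonsingularVectors B, ((singularVectors B).filter fun w => B w z = 0).card =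
      ∑ w ∈ singularVectors B, ((nonsingularVectors B).filter fun z => B w z = 0).card :=
    Finset.sum_card_bipartiteAbove_eq_sum_card_bipartiteBelow fun z w => B w z = 0
  rw [Finset.sum_congr rfl fun z hz => card_singularVectors_orthogonal_eq hq hs hB h2 hm
    ((mem_nonsingularVectors B).1 hz) hx, Finset.sum_const, smul_eq_mul] at hdc
  zify at hdc
  rw [Finset.sum_congr rfl fun w hw =>
    (card_singularVectors_orthogonal_singular hs hB h2 hV hk hw).2, Finset.sum_const,
    nsmul_eq_mul, hk] at hdc
  have hk' := card_singularVectors_add B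
  rw [hV] at hk'
  zify at hk'
  have hk'' : ((nonsingularVectors B).card : ℤ) =
      t * (Fintype.card F - 1) * (Fintype.card F * t + 1) := by linear_combination hk' - hk
  rw [hk''] at hdc
  have hP : (((singularVectors B).filter fun w => B w x = 0).card : ℤ) = t ^ 2 - 1 := by
    have hne : (t : ℤ) * (Fintype.card F - 1) * (Fintype.card F * t + 1) ≠ 0 := by
      have : (1 : ℤ) < Fintype.card F := by exact_mod_cast hq1
      have : (0 : ℤ) < Fintype.card F - 1 := by linarith
      positivity
    exact mul_left_cancel₀ hne (by linear_combination hdc)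
  have hsx : ∀ z, B z x = B x z := fun z => hs.eq z x
  simp only [hsx] at hP ⊢
  have hf : B x ≠ 0 := fun h => hx (by rw [h]; rfl)
  have h1 := card_mul_card_filter_eq_zero (B x) hf
  rw [hV] at h1
  have h6 := card_filter_add_card_filter B (B x)
  zify at h1 h6
  have hh : ((Finset.univ.filter fun z => B x z = 0).card : ℤ) = Fintype.card F * t ^ 2 :=
    mul_left_cancel₀ hq0 (by linear_combination h1)
  linear_combination h6 - hP + hh

/-- The ratio bound for cliques. -/
theorem card_mul_le_of_sub_singular (hs : B.IsSymm) (hB : B.Nondegenerate) (h2 : (2 : F) ≠ 0)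
    {t : ℕ} (ht : 1 < t) (hV : Fintype.card V = Fintype.card F ^ 2 * t ^ 2)
    (hk : ((singularVectors B).card : ℤ) = (Fintype.card F * t + 1) * (t - 1))
    (C : Finset V) (hC : ∀ x ∈ C, ∀ y ∈ C, x ≠ y → B (x - y) (x - y) = 0) :
    (C.card : ℤ) * ((Fintype.card F - 1) * t + 1) ≤ Fintype.card F * t ^ 2 := by
  classical
  have hq1 : (1 : ℤ) < Fintype.card F := by exact_mod_cast Fintype.one_lt_card
  rcases Nat.eq_zero_or_pos C.card with h0 | h0
  · rw [h0]
    simp only [Nat.cast_zero, zero_mul]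
    positivity
  have hP : ∀ z ∈ singularVectors B, (((singularVectors B).filter fun w => B w z = 0).card : ℤ) =
      t ^ 2 - Fintype.card F * t + t - 1 := fun z hz => by
    have hsz : ∀ w, B w z = B z w := fun w => hs.eq w z
    simp only [hsz]
    exact (card_singularVectors_orthogonal_singular hs hB h2 hV hk hz).1
  have hk0 : 0 < (singularVectors B).card := by
    zify
    rw [hk]
    have : (0 : ℤ) < t - 1 := by
      rw [sub_pos]
      exact_mod_cast ht
    positivity
  obtain ⟨w, hw⟩ := Finset.card_pos.1 hk0
  have h := sq_card_mul_card_add_le B (singularVectors B) C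
    ((singularVectors B).filter fun z => B z w = 0).card fun x hx y hy hxy => by
      have := hP _ ((mem_singularVectors B).2 ⟨sub_ne_zero.2 hxy, hC x hx y hy hxy⟩)
      rw [← hP w hw] at this
      exact_mod_cast this
  zify at h h0
  rw [hP w hw, hk] at h
  have : 0 < (C.card : ℤ) * (Fintype.card F - 1) := mul_pos h0 (by linarith)
  refine le_of_mul_le_mul_left ?_ this
  linarith

/-- The ratio bound for independent sets. -/
theorem card_le_of_sub_nonsingular (hq : Odd (Fintype.card F)) (hs : B.IsSymm)
    (hB : B.Nondegenerate) (h2 : (2 : F) ≠ 0) {m : ℕ} (hm : Module.finrank F V = m + m)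
    {t : ℕ} (ht : t ≠ 0) (hV : Fintype.card V = Fintype.card F ^ 2 * t ^ 2)
    (hk : ((singularVectors B).card : ℤ) = (Fintype.card F * t + 1) * (t - 1))
    (C : Finset V) (hC : ∀ x ∈ C, ∀ y ∈ C, x ≠ y → B (x - y) (x - y) ≠ 0) :
    (C.card : ℤ) ≤ Fintype.card F * ((Fintype.card F - 1) * t + 1) := by
  classical
  have hq1 : (1 : ℤ) < Fintype.card F := by exact_mod_cast Fintype.one_lt_card
  have ht0 : (0 : ℤ) < t := by positivity
  have h := sq_card_mul_card_add_le B (nonsingularVectors B) C ((Fintype.card F - 1) * t ^ 2)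
    fun x hx y hy hxy => by
      have := card_nonsingularVectors_orthogonal_nonsingular hq hs hB h2 hm ht hV hk
        ((mem_nonsingularVectors B).2 (hC x hx y hy hxy))
      zify [Fintype.one_lt_card.le]
      rw [this]
  rcases Nat.eq_zero_or_pos C.card with h0 | h0
  · rw [h0]
    have : (0 : ℤ) < Fintype.card F - 1 := by linarith
    simp only [Nat.cast_zero]
    positivity
  have hk' := card_singularVectors_add B
  rw [hV] at hk'
  zify [Fintype.one_lt_card.le] at h h0 hk'
  have hk'' : ((nonsingularVectors B).card : ℤ) =
      t * (Fintype.card F - 1) * (Fintype.card F * t + 1) := by linear_combination hk' - hk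
  rw [hk''] at h
  have : 0 < (C.card : ℤ) * (t * (Fintype.card F - 1)) :=
    mul_pos h0 (mul_pos ht0 (by linarith))
  refine le_of_mul_le_mul_left ?_ this
  linarith

/-- The two bounds multiply to at most `q ^ (2 m)`, and equality in the first is impossible because
`(q - 1) t + 1` is coprime to `q t ^ 2`. -/
theorem mul_lt_of_bounds {q t c s : ℤ} (hq : 1 < q) (ht : 0 < t) (hqt : q ∣ t) (hc0 : 0 ≤ c)
    (hc : c * ((q - 1) * t + 1) ≤ q * t ^ 2) (hs : s ≤ q * ((q - 1) * t + 1)) :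
    c * s < q ^ 2 * t ^ 2 := by
  have hD : 1 < (q - 1) * t + 1 := by nlinarith
  have hne : c * ((q - 1) * t + 1) ≠ q * t ^ 2 := by
    intro h
    obtain ⟨u, hu⟩ := hqt
    have hct : IsCoprime ((q - 1) * t + 1) t := ⟨1, -(q - 1), by ring⟩
    have hcq : IsCoprime ((q - 1) * t + 1) q := ⟨1, -(q - 1) * u, by rw [hu]; ring⟩
    have := (hcq.mul_right (hct.pow_right (n := 2))).isUnit_of_dvd' dvd_rfl (Dvd.intro_left c h)
    rcases Int.isUnit_iff.1 this with h | h <;> linarith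
  have hlt := lt_of_le_of_ne hc hne
  calc c * s ≤ c * (q * ((q - 1) * t + 1)) := by gcongr
    _ = q * (c * ((q - 1) * t + 1)) := by ring
    _ < q * (q * t ^ 2) := by gcongr
    _ = q ^ 2 * t ^ 2 := by ring

end Elliptic

/-! ### The elliptic affine polar graph -/

section AffinePolar

variable {F : Type*} [Field F] {n : ℕ} (A : Matrix (Fin n) (Fin n) F)

theorem affinePolarGraph_adj {x y : Fin n → F} : (affinePolarGraph A).Adj x y ↔
    x ≠ y ∧ A.toBilin' (x - y) (x - y) = 0 := by
  rw [Matrix.toBilin'_apply']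
  rfl

theorem isSymm_toBilin' (hA : A.IsSymm) : A.toBilin'.IsSymm := by
  refine LinearMap.BilinForm.isSymm_def.2 fun x y => ?_
  rw [Matrix.toBilin'_apply', Matrix.toBilin'_apply', Matrix.dotProduct_mulVec,
    ← Matrix.mulVec_transpose, hA.eq, dotProduct_comm]

/-- Every point of the quadric is spanned by exactly `q - 1` nonzero singular vectors. -/
theorem ncard_quadric_mul [Fintype F] :
    (quadric A).ncard * (Fintype.card F - 1) = (singularVectors A.toBilin').card := by
  classical
  have h : quadric A =
      ((singularVectors A.toBilin').image fun x => Submodule.span F {x} : Finset _) := by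
    ext U
    simp only [quadric, Set.mem_ofPred_eq, Finset.coe_image, Set.mem_image, Finset.mem_coe,
      mem_singularVectors, Matrix.toBilin'_apply', and_assoc, eq_comm]
  rw [h, Set.ncard_coe_finset, Finset.card_eq_sum_card_image (fun x => Submodule.span F {x})
    (singularVectors A.toBilin'),
    ← smul_eq_mul, ← Finset.sum_const]
  refine Finset.sum_congr rfl fun U hU => ?_
  obtain ⟨x, hx, rfl⟩ := Finset.mem_image.1 hU
  rw [mem_singularVectors] at hx
  have hfib : ((singularVectors A.toBilin').filter fun y =>
      Submodule.span F {y} = Submodule.span F {x}) =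
      (Finset.univ : Finset Fˣ).image fun u => u • x := by
    ext y
    simp only [Finset.mem_filter, Finset.mem_image, Finset.mem_univ, true_and,
      mem_singularVectors]
    rw [eq_comm (a := Submodule.span F {y}), Submodule.span_singleton_eq_span_singleton]
    refine ⟨fun h => h.2, ?_⟩
    rintro ⟨u, rfl⟩
    refine ⟨⟨Units.smul_def u x ▸ smul_ne_zero u.ne_zero hx.1, ?_⟩, u, rfl⟩
    simp [Units.smul_def, hx.2]
  rw [hfib, Finset.card_image_of_injective, Finset.card_univ, Fintype.card_units]
  intro u v huv
  exact Units.ext (smul_left_injective F hx.1 (by simpa [Units.smul_def] using huv))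

/-- A similitude followed by a translation takes any nonadjacent pair to any other. -/
theorem affinePolarGraph_transitive {A}
    (htrans : ∀ x y : Fin n → F, A.toBilin' x x ≠ 0 → A.toBilin' y y ≠ 0 →
      ∃ e : (Fin n → F) →ₗ[F] Fin n → F, IsSimilitude A.toBilin' e ∧ e x = y)
    (hB : A.toBilin'.Nondegenerate) {x y x' y' : Fin n → F} (hxy : x ≠ y)
    (hadj : ¬ (affinePolarGraph A).Adj x y) (hxy' : x' ≠ y')
    (hadj' : ¬ (affinePolarGraph A).Adj x' y') :
    ∃ σ : affinePolarGraph A →g affinePolarGraph A, σ x = x' ∧ σ y = y' := by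
  simp only [affinePolarGraph_adj, hxy, hxy', ne_eq, not_false_eq_true, true_and] at hadj hadj'
  obtain ⟨e, he, hexy⟩ := htrans _ _ hadj hadj'
  refine ⟨⟨fun v => e (v - y) + y', fun {u v} h => ?_⟩, ?_, ?_⟩
  · rw [affinePolarGraph_adj] at h ⊢
    rw [add_sub_add_right_eq_sub, ← map_sub, sub_sub_sub_cancel_right, he.apply_eq_zero_iff]
    exact ⟨fun h' => h.1 (by simpa using he.injective hB (add_right_cancel h')), h.2⟩
  · change e (x - y) + y' = x'
    rw [hexy, sub_add_cancel]
  · change e (y - y) + y' = y'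
    simp

end AffinePolar

theorem theorem4p9 {F : Type*} [Field F] [Fintype F] (hq : Odd (Fintype.card F))
    {n : ℕ} (hn : 4 ≤ n) (hn_even : Even n)
    (A : Matrix (Fin n) (Fin n) F) (hA : IsElliptic A) :
    IsCore (affinePolarGraph A) ∧
    (∀ H : (affinePolarGraph A).Subgraph, IsCoreOf H → H.coe ≠ ⊤) ∧
    (∀ H : ((affinePolarGraph A)ᶜ).Subgraph, IsCoreOf H → H.coe ≠ ⊤) ∧
    (affinePolarGraph A).cliqueNum * (affinePolarGraph A).indepNum < Fintype.card F ^ n := by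
  have h2 : (2 : F) ≠ 0 := Ring.two_ne_zero fun h =>
    Nat.not_even_iff_odd.2 hq (Nat.even_iff.2 (FiniteField.even_card_iff_char_two.1 h))
  have hs := isSymm_toBilin' A hA.symm
  have hB : A.toBilin'.Nondegenerate := LinearMap.BilinForm.nondegenerate_toBilin'_of_det_ne_zero' A
    ((Matrix.isUnit_iff_isUnit_det A).1 hA.invertible).ne_zero
  obtain ⟨m, rfl⟩ := hn_even
  have hfr : Module.finrank F (Fin (m + m) → F) = m + m := by simp
  have hq1 : 1 < Fintype.card F := Fintype.one_lt_card
  -- With `m = k + 2`, the parameter `t` of the counting lemmas is `q ^ (m - 1) = q ^ (k + 1)`.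
  obtain ⟨k, rfl⟩ : ∃ k, m = k + 2 := ⟨m - 2, by omega⟩
  set q := Fintype.card F
  have ht : 1 < q ^ (k + 1) := Nat.one_lt_pow (by omega) hq1
  have hV : Fintype.card (Fin (k + 2 + (k + 2)) → F) = q ^ 2 * (q ^ (k + 1)) ^ 2 := by
    simp only [Fintype.card_fun, Fintype.card_fin]
    ring
  have hk : ((singularVectors A.toBilin').card : ℤ) =
      (q * (q ^ (k + 1) : ℕ) + 1) * ((q ^ (k + 1) : ℕ) - 1) := by
    rw [← ncard_quadric_mul, hA.card_quadric, show (k + 2 + (k + 2)) / 2 = k + 2 by omega,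
      show k + 2 - 1 = k + 1 by omega, Nat.cast_mul, Nat.cast_sub ht.le]
    push_cast
    ring
  have hlt : (affinePolarGraph A).cliqueNum * (affinePolarGraph A).indepNum <
      q ^ (k + 2 + (k + 2)) := by
    obtain ⟨C, hC, hCc⟩ := (affinePolarGraph A).exists_isNClique_cliqueNum
    obtain ⟨S, hS, hSc⟩ := (affinePolarGraph A).exists_isNIndepSet_indepNum
    have hC' := card_mul_le_of_sub_singular hs hB h2 ht hV hk C fun x hx y hy hxy =>
      ((affinePolarGraph_adj A).1 (hC hx hy hxy)).2
    have hS' := card_le_of_sub_nonsingular hq hs hB h2 hfr (by omega) hV hk S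
      fun x hx y hy hxy h => hS hx hy hxy ((affinePolarGraph_adj A).2 ⟨hxy, h⟩)
    have := mul_lt_of_bounds (by exact_mod_cast hq1) (by positivity)
      (by exact_mod_cast dvd_pow_self q (Nat.succ_ne_zero k)) (by positivity) hC' hS'
    rw [← hCc, ← hSc]
    zify
    refine this.trans_eq ?_
    push_cast
    ring
  have hlt' : (affinePolarGraph A).cliqueNum * (affinePolarGraph A).indepNum <
      Nat.card (Fin (k + 2 + (k + 2)) → F) := by
    rw [Nat.card_eq_fintype_card, hV]
    refine hlt.trans_eq ?_
    ring
  refine ⟨SimpleGraph.isCore_of_transitive (fun x y x' y' h1 h2' h3 h4 =>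
      affinePolarGraph_transitive
        (fun x y hx hy => exists_isSimilitude_apply_eq hq hs hB h2 hfr hx hy) hB h1 h2' h3 h4) hlt',
    fun H hH ht => hlt'.not_ge (SimpleGraph.card_le_of_isCoreOf_eq_top hH ht),
    fun H hH ht => hlt'.not_ge ?_, hlt⟩
  have := SimpleGraph.card_le_of_isCoreOf_eq_top hH ht
  rwa [SimpleGraph.cliqueNum_compl, SimpleGraph.indepNum_compl, mul_comm] at this
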